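/- **Theorem 6.2.** Formulae are built from a countable set of variables by the binary connectives $\backslash$, $/$, $\cdot$ and the unary connective ${}^*$. A sequent is an expression $A_1,\dots,A_n\to B$ with $n\ge 0$, where the $A_i$ and $B$ are formulae; $\Lambda$ denotes the empty sequence of formulae. The calculus $\mathbf{L}^{*}_{\omega}$ has the axioms $A\to A$ and the following rules, where $\Gamma,\Delta,\Pi,\Pi_i$ are arbitrary (possibly empty) finite sequences of formulae: - from $\Pi\to A$ and $\Gamma,B,\Delta\to C$ infer $\Gamma,\Pi,A\backslash B,\Delta\to C$; from $A,\Pi\to B$ infer $\Pi\to A\backslash B$; - from $\Pi\to A$ and $\Gamma,B,\Delta\to C$ infer $\Gamma,B/A,\Pi,\Delta\to C$; from $\Pi,A\to B$ infer $\Pi\to B/A$; - from $\Gamma,A,B,\Delta\to C$ infer $\Gamma,A\cdot B,\Delta\to C$; from $\Gamma\to A$ and $\Delta\to B$ infer $\Gamma,\Delta\to A\cdot B$; - from $\Gamma,A^n,\Delta\to C$ for all $n\ge 0$ infer $\Gamma,A^*,\Delta\to C$ (here $A^n$ is $A,\dots,A$, $n$ times); for each $n\ge 0$, from $\Pi_1\to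 A,\ \dots,\ \Pi_n\to A$ infer $\Pi_1,\dots,\Pi_n\to A^*$; - (cut) from $\Pi\to A$ and $\Gamma,A,\Delta\to C$ infer $\Gamma,\Pi,\Delta\to C$. A sequent is derivable in $\mathbf{L}^{*}_{\omega}$ if it belongs to the smallest set of sequents that contains all axioms and is closed under all rules. The *-external formulae form the smallest class that contains all formulae in the language of $\backslash$ and $/$ only and is closed under $A,B\mapsto A\cdot B$ and $A\mapsto A^*$. A sequent $A_1,\dots,A_n\to B$ is *-external if all $A_i$ are *-external and $B$ is a formula in the language of $\backslash$ and $/$ only. An L-model over an alphabet $\Sigma$ (an arbitrary set) interprets each variable by an arbitrary language over $\Sigma$, i.e. a subset of $\Sigma^*$ (the set of all finite words over $\Sigma$), and extends this to all formulae by $$A\cdot B=\{uv\mid u\in A,\ v\in B\},\qquad A\backslash B=\{u\in\Sigma^*\mid \forall v\in A\ \ vu\in B\},\qquad B/A=\{u\in\Sigma^*\mid\forall v\in A\ \ uv\in B\},$$ $A^*=\bigcup_{n\ge 0}A^n$, where $A^0=\{\varepsilon\}$ consists of the empty word. A REGLAN-model is an L-model over a finite alphabet in which all variables are interpreted by regular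 languages. An R-model interprets each variable by an arbitrary binary relation on a set $W$ and extends this to all formulae by $R\cdot S=R\circ S=\{\langle x,z\rangle\mid\exists y\ \langle x,y\rangle\in R,\ \langle y,z\rangle\in S\}$, $$R\backslash S=\{\langle y,z\rangle\in W\times W\mid\forall x\,(\langle x,y\rangle\in R\Rightarrow\langle x,z\rangle\in S)\},\qquad S/R=\{\langle x,y\rangle\in W\times W\mid\forall z\,(\langle y,z\rangle\in R\Rightarrow\langle x,z\rangle\in S)\},$$ $R^*=\bigcup_{n\ge 0}R^n$, where $R^0$ is the identity relation on $W$. In each case a sequent $A_1,\dots,A_n\to B$ is true in the model if the interpretation of $A_1\cdot\ldots\cdot A_n$ is a subset of that of $B$; for $n=0$ the left-hand side is $\{\varepsilon\}$ (respectively, the identity relation on $W$). Let $A_1,\dots,A_n\to B$ be a *-external sequent. Then each of the following equivalences holds: 1. it is derivable in $\mathbf{L}^{*}_{\omega}$ if and only if it is true in all L-models; 2. it is derivable in $\mathbf{L}^{*}_{\omega}$ if and only if it is true in all REGLAN-models; 3. it is derivable in $\mathbf{L}^{*}_{\omega}$ if and only if it is true in all R-models. -/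

import Mathlib

universe u v w

namespace LambekStar

/-- Formulae of the Lambek calculus with iteration (no unit, no additives), over the countable
set of variables `p 0, p 1, p 2, …`. -/
inductive Formula : Type
  | var : ℕ → Formula
  /-- `ldiv A B` is the left division `A \ B`. -/
  | ldiv : Formula → Formula → Formula
  /-- `rdiv B A` is the right division `B / A`. -/
  | rdiv : Formula → Formula → Formula
  /-- `mul A B` is the product `A · B`. -/
  | mul : Formula → Formula → Formula
  /-- `star A` is the iteration `A*`. -/
  | star : Formula → Formula

/-- `Derivable Γ C`: the sequent `Γ → C` is a theorem of the infinitary calculus `L*_ω`, i.e. it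
belongs to the smallest set of sequents that contains all axioms and is closed under all rules,
including the ω-rule `star_left`. Antecedents may be empty. -/
inductive Derivable : List Formula → Formula → Prop
  | ax (A : Formula) : Derivable [A] A
  | ldiv_left (Γ Θ Δ : List Formula) (A B C : Formula) :
      Derivable Θ A → Derivable (Γ ++ [B] ++ Δ) C → Derivable (Γ ++ Θ ++ [.ldiv A B] ++ Δ) C
  | ldiv_right (Θ : List Formula) (A B : Formula) :
      Derivable ([A] ++ Θ) B → Derivable Θ (.ldiv A B)
  | rdiv_left (Γ Θ Δ : List Formula) (A B C : Formula) :
      Derivable Θ A → Derivable (Γ ++ [B] ++ Δ) C → Derivable (Γ ++ [.rdiv B A] ++ Θ ++ Δ) C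
  | rdiv_right (Θ : List Formula) (A B : Formula) :
      Derivable (Θ ++ [A]) B → Derivable Θ (.rdiv B A)
  | mul_left (Γ Δ : List Formula) (A B C : Formula) :
      Derivable (Γ ++ [A, B] ++ Δ) C → Derivable (Γ ++ [.mul A B] ++ Δ) C
  | mul_right (Γ Δ : List Formula) (A B : Formula) :
      Derivable Γ A → Derivable Δ B → Derivable (Γ ++ Δ) (.mul A B)
  | star_left (Γ Δ : List Formula) (A C : Formula) :
      (∀ n : ℕ, Derivable (Γ ++ List.replicate n A ++ Δ) C) → Derivable (Γ ++ [.star A] ++ Δ) C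
  | star_right (Θs : List (List Formula)) (A : Formula) :
      (∀ Θ ∈ Θs, Derivable Θ A) → Derivable Θs.flatten (.star A)
  | cut (Γ Θ Δ : List Formula) (A C : Formula) :
      Derivable Θ A → Derivable (Γ ++ [A] ++ Δ) C → Derivable (Γ ++ Θ ++ Δ) C

/-- Formulae in the language of the two divisions only. -/
inductive DivisionOnly : Formula → Prop
  | var (i : ℕ) : DivisionOnly (.var i)
  | ldiv {A B : Formula} : DivisionOnly A → DivisionOnly B → DivisionOnly (.ldiv A B)
  | rdiv {B A : Formula} : DivisionOnly B → DivisionOnly A → DivisionOnly (.rdiv B A)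

/-- *-external formulae: no product and no star within the scope of a division. -/
inductive StarExternal : Formula → Prop
  | ofDivisionOnly {A : Formula} : DivisionOnly A → StarExternal A
  | mul {A B : Formula} : StarExternal A → StarExternal B → StarExternal (.mul A B)
  | star {A : Formula} : StarExternal A → StarExternal (.star A)

/-- The sequent `Γ → B` is *-external. -/
def StarExternalSequent (Γ : List Formula) (B : Formula) : Prop :=
  (∀ A ∈ Γ, StarExternal A) ∧ DivisionOnly B

section LanguageModels

open scoped Computability

/-- Interpretation of formulae in the algebra of all languages over the alphabet `α`. -/
def langInterp {α : Type u} (val : ℕ → Language α) : Formula → Language α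
  | .var i => val i
  | .ldiv A B => {x : List α | ∀ y ∈ langInterp val A, y ++ x ∈ langInterp val B}
  | .rdiv B A => {x : List α | ∀ y ∈ langInterp val A, x ++ y ∈ langInterp val B}
  | .mul A B => langInterp val A * langInterp val B
  | .star A => (langInterp val A)∗

/-- The sequent `Γ → B` is true in the language model given by `val`: the concatenation of the
interpretations of the formulae of `Γ` (the language `{ε}` if `Γ` is empty) is included in the
interpretation of `B`. -/
def LangTrue {α : Type u} (val : ℕ → Language α) (Γ : List Formula) (B : Formula) : Prop :=
  ∀ x ∈ (Γ.map (langInterp val)).prod, x ∈ langInterp val B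

/-- Truth in all L-models (over arbitrary alphabets, finite or infinite). -/
def TrueInAllLModels (Γ : List Formula) (B : Formula) : Prop :=
  ∀ (α : Type u) (val : ℕ → Language α), LangTrue val Γ B

/-- Truth in all REGLAN-models: the L-models over finite alphabets in which every variable is
interpreted by a regular language. -/
def TrueInAllReglanModels (Γ : List Formula) (B : Formula) : Prop :=
  ∀ (α : Type u) [Finite α] (val : ℕ → Language α), (∀ i, (val i).IsRegular) → LangTrue val Γ B

end LanguageModels

section RelationalModels

/-- `n`-fold composition of a binary relation with itself; the `0`-th power is the identity. -/
def relPow {W : Type u} (R : SetRel W W) : ℕ → SetRel W W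
  | 0 => SetRel.id
  | n + 1 => R.comp (relPow R n)

/-- Interpretation of formulae by binary relations on `W`. -/
def relInterp {W : Type u} (val : ℕ → SetRel W W) : Formula → SetRel W W
  | .var i => val i
  | .ldiv A B => {p | ∀ x, (x, p.1) ∈ relInterp val A → (x, p.2) ∈ relInterp val B}
  | .rdiv B A => {p | ∀ z, (p.2, z) ∈ relInterp val A → (p.1, z) ∈ relInterp val B}
  | .mul A B => (relInterp val A).comp (relInterp val B)
  | .star A => ⋃ n : ℕ, relPow (relInterp val A) n

/-- Composition of the interpretations of the formulae of an antecedent, in order; the identity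
relation for the empty antecedent. -/
def relAntecedent {W : Type u} (val : ℕ → SetRel W W) : List Formula → SetRel W W
  | [] => SetRel.id
  | A :: Γ => (relInterp val A).comp (relAntecedent val Γ)

/-- The sequent `Γ → B` is true in the relational model given by `val`. -/
def RelTrue {W : Type u} (val : ℕ → SetRel W W) (Γ : List Formula) (B : Formula) : Prop :=
  relAntecedent val Γ ⊆ relInterp val B

/-- Truth in all (square) R-models. -/
def TrueInAllRModels (Γ : List Formula) (B : Formula) : Prop :=
  ∀ (W : Type u) (val : ℕ → SetRel W W), RelTrue val Γ B

end RelationalModels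

end LambekStar

namespace LambekStar

/-! ### Soundness for language models. -/

section LanguageSoundness

open scoped Computability

/-! Soundness is induction on derivations. For completeness, `expansions` turns each external
product into a concatenation and each external star into a finite iteration. By the left rules (the
ω-rule for star), a sequent is derivable once all its expansions are; by the right rules and
soundness, truth passes to every expansion. Expansions of a *-external sequent contain only
divisions, so two canonical models for the division fragment suffice.

REGLAN-models: letters are the finitely many subformulae, and a variable `p` gets all words deriving
`p` together with all words of large weight. These languages are cofinite, hence regular, and
`boundedVal_truth` controls the truncation. L-models include REGLAN-models, so they need no separate
construction.

R-models: over the free group on all formulae, `A` relates `x` to `x * posWord U` when `U` derives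
`A`. Inverses provide the predecessors needed to test a division, and two distinct letters deriving
`A` force the quotient to be a positive word. -/

theorem mul_ldiv_le {α : Type u} (val : ℕ → Language α) (A B : Formula) :
    langInterp val A * langInterp val (.ldiv A B) ≤ langInterp val B := by
  intro x hx
  obtain ⟨a, ha, b, hb, rfl⟩ := Language.mem_mul.1 hx
  exact hb a ha

theorem rdiv_mul_le {α : Type u} (val : ℕ → Language α) (A B : Formula) :
    langInterp val (.rdiv B A) * langInterp val A ≤ langInterp val B := by
  intro x hx
  obtain ⟨a, ha, b, hb, rfl⟩ := Language.mem_mul.1 hx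
  exact ha b hb

theorem Derivable.prod_langInterp_le {α : Type u} (val : ℕ → Language α) {Γ : List Formula}
    {B : Formula} (h : Derivable Γ B) : (Γ.map (langInterp val)).prod ≤ langInterp val B := by
  induction h with
  | ax A => simp
  | ldiv_left Γ Θ Δ A B C _ _ ih₁ ih₂ =>
    refine le_trans ?_ ih₂
    simp only [List.map_append, List.prod_append, List.map_cons, List.map_nil, List.prod_cons,
      List.prod_nil, mul_one]
    refine mul_le_mul' ?_ le_rfl
    rw [mul_assoc]
    exact mul_le_mul' le_rfl ((mul_le_mul' ih₁ le_rfl).trans (mul_ldiv_le val A B))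
  | ldiv_right Θ A B _ ih =>
    intro x hx y hy
    refine ih (?_ : _ ∈ (_ : Language α))
    simpa using Language.append_mem_mul hy hx
  | rdiv_left Γ Θ Δ A B C _ _ ih₁ ih₂ =>
    refine le_trans ?_ ih₂
    simp only [List.map_append, List.prod_append, List.map_cons, List.map_nil, List.prod_cons,
      List.prod_nil, mul_one]
    refine mul_le_mul' ?_ le_rfl
    rw [mul_assoc]
    exact mul_le_mul' le_rfl ((mul_le_mul' le_rfl ih₁).trans (rdiv_mul_le val A B))
  | rdiv_right Θ A B _ ih =>
    intro x hx y hy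
    refine ih (?_ : _ ∈ (_ : Language α))
    simpa using Language.append_mem_mul hx hy
  | mul_left Γ Δ A B C _ ih =>
    refine le_trans (le_of_eq ?_) ih
    simp [langInterp, mul_assoc]
  | mul_right Γ Δ A B _ _ ih₁ ih₂ =>
    simpa [langInterp] using mul_le_mul' ih₁ ih₂
  | star_left Γ Δ A C _ ih =>
    simp only [List.map_append, List.prod_append, List.map_cons, List.map_nil, List.prod_cons,
      List.prod_nil, mul_one, langInterp, Language.kstar_eq_iSup_pow, Language.mul_iSup,
      Language.iSup_mul]
    refine iSup_le fun n => ?_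
    simpa [mul_assoc] using ih n
  | star_right Θs A _ ih =>
    induction Θs with
    | nil => simp [langInterp]
    | cons Θ Θs ih' =>
      have h₁ := ih Θ (by simp)
      have h₂ := ih' (fun Θ h => by grind) (fun Θ h => ih Θ (by simp [h]))
      simp only [List.flatten_cons, List.map_append, List.prod_append]
      exact (mul_le_mul' h₁ h₂).trans mul_kstar_le_kstar
  | cut Γ Θ Δ A C _ _ ih₁ ih₂ =>
    refine le_trans ?_ ih₂
    simp only [List.map_append, List.prod_append, List.map_cons, List.map_nil, List.prod_cons,
      List.prod_nil, mul_one]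
    exact mul_le_mul' (mul_le_mul' le_rfl ih₁) le_rfl

end LanguageSoundness

/-! ### Soundness for relational models. -/

section RelationalSoundness

variable {W : Type u} (val : ℕ → SetRel W W)

theorem mem_relAntecedent_append {Γ Δ : List Formula} {x z : W} :
    (x, z) ∈ relAntecedent val (Γ ++ Δ) ↔
      ∃ y, (x, y) ∈ relAntecedent val Γ ∧ (y, z) ∈ relAntecedent val Δ := by
  induction Γ generalizing x with
  | nil => simp [relAntecedent]
  | cons A Γ ih =>
    simp only [List.cons_append, relAntecedent, SetRel.mem_comp, ih]
    grind

theorem mem_relAntecedent_singleton {A : Formula} {x y : W} :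
    (x, y) ∈ relAntecedent val [A] ↔ (x, y) ∈ relInterp val A := by
  simp [relAntecedent]

theorem mem_relAntecedent_replicate {A : Formula} {n : ℕ} {x y : W} :
    (x, y) ∈ relAntecedent val (List.replicate n A) ↔ (x, y) ∈ relPow (relInterp val A) n := by
  induction n generalizing x with
  | zero => simp [relAntecedent, relPow]
  | succ n ih => simp [List.replicate_succ, relAntecedent, relPow, ih]

theorem Derivable.relTrue {Γ : List Formula} {B : Formula} (h : Derivable Γ B) :
    RelTrue val Γ B := by
  rintro ⟨x, y⟩ hxy
  induction h generalizing x y with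
  | ax A => exact (mem_relAntecedent_singleton val).1 hxy
  | ldiv_left Γ Θ Δ A B C _ _ ih₁ ih₂ =>
    simp only [mem_relAntecedent_append, mem_relAntecedent_singleton] at hxy ih₂
    obtain ⟨c, ⟨b, ⟨a, h₁, h₂⟩, h₃⟩, h₄⟩ := hxy
    exact ih₂ _ _ ⟨c, ⟨a, h₁, h₃ a (ih₁ _ _ h₂)⟩, h₄⟩
  | ldiv_right Θ A B _ ih =>
    intro z hz
    refine ih _ _ ?_
    rw [mem_relAntecedent_append]
    exact ⟨x, (mem_relAntecedent_singleton val).2 hz, hxy⟩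
  | rdiv_left Γ Θ Δ A B C _ _ ih₁ ih₂ =>
    simp only [mem_relAntecedent_append, mem_relAntecedent_singleton] at hxy ih₂
    obtain ⟨c, ⟨b, ⟨a, h₁, h₂⟩, h₃⟩, h₄⟩ := hxy
    exact ih₂ _ _ ⟨c, ⟨a, h₁, h₂ c (ih₁ _ _ h₃)⟩, h₄⟩
  | rdiv_right Θ A B _ ih =>
    intro z hz
    refine ih _ _ ?_
    rw [mem_relAntecedent_append]
    exact ⟨y, hxy, (mem_relAntecedent_singleton val).2 hz⟩
  | mul_left Γ Δ A B C _ ih =>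
    refine ih _ _ ?_
    simp only [mem_relAntecedent_append, relInterp, relAntecedent, SetRel.mem_comp] at hxy ⊢
    obtain ⟨c, ⟨a, h₁, _, ⟨b, h₂, h₃⟩, rfl⟩, h₄⟩ := hxy
    exact ⟨_, ⟨a, h₁, b, h₂, _, h₃, rfl⟩, h₄⟩
  | mul_right Γ Δ A B _ _ ih₁ ih₂ =>
    obtain ⟨z, h₁, h₂⟩ := (mem_relAntecedent_append val).1 hxy
    exact ⟨z, ih₁ _ _ h₁, ih₂ _ _ h₂⟩
  | star_left Γ Δ A C _ ih =>
    simp only [mem_relAntecedent_append, mem_relAntecedent_singleton, relInterp,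
      Set.mem_iUnion] at hxy
    obtain ⟨b, ⟨a, h₁, n, h₂⟩, h₃⟩ := hxy
    refine ih n _ _ ?_
    simp only [mem_relAntecedent_append, mem_relAntecedent_replicate]
    exact ⟨b, ⟨a, h₁, h₂⟩, h₃⟩
  | star_right Θs A _ ih =>
    refine Set.mem_iUnion.2 ⟨Θs.length, ?_⟩
    induction Θs generalizing x with
    | nil => exact hxy
    | cons Θ Θs ih' =>
      obtain ⟨z, h₁, h₂⟩ := (mem_relAntecedent_append val).1 hxy
      exact ⟨z, ih Θ (by simp) _ _ h₁,
        ih' (fun Θ h => by grind) (fun Θ h => ih Θ (by simp [h])) _ h₂⟩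
  | cut Γ Θ Δ A C _ _ ih₁ ih₂ =>
    simp only [mem_relAntecedent_append, mem_relAntecedent_singleton] at hxy ih₂
    obtain ⟨b, ⟨a, h₁, h₂⟩, h₃⟩ := hxy
    exact ih₂ _ _ ⟨b, ⟨a, h₁, ih₁ _ _ h₂⟩, h₃⟩

end RelationalSoundness

/-! ### Reduction to sequents with divisions only. -/

section Expansions

open scoped Computability

/-- The sequences of formulae obtained from a formula by replacing its external products by
concatenations and its external stars by finite iterations. -/
def expansions : Formula → Language Formula
  | .var i => ({[.var i]} : Set (List Formula))
  | .ldiv A B => ({[.ldiv A B]} : Set (List Formula))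
  | .rdiv B A => ({[.rdiv B A]} : Set (List Formula))
  | .mul A B => expansions A * expansions B
  | .star A => (expansions A)∗

theorem DivisionOnly.mem_expansions_iff {A : Formula} (hA : DivisionOnly A) {U : List Formula} :
    U ∈ expansions A ↔ U = [A] := by
  cases hA <;> rfl

theorem derivable_of_mem_expansions {A : Formula} {U : List Formula} (hU : U ∈ expansions A) :
    Derivable U A := by
  induction A generalizing U with
  | var | ldiv | rdiv => cases hU; exact .ax _
  | mul A B ihA ihB =>
    obtain ⟨V, hV, W, hW, rfl⟩ := Language.mem_mul.1 hU
    exact .mul_right _ _ _ _ (ihA hV) (ihB hW)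
  | star A ih =>
    obtain ⟨L, rfl, hL⟩ := Language.mem_kstar.1 hU
    exact .star_right _ _ fun Θ hΘ => ih (hL Θ hΘ)

/-- The copies of `A` are expanded one at a time, the expansion of the leftmost being absorbed into
the left context. -/
theorem derivable_replicate_of_expansions {A C : Formula} {Γ Δ : List Formula} {n : ℕ}
    (ih : ∀ Γ Δ : List Formula, (∀ U ∈ expansions A, Derivable (Γ ++ U ++ Δ) C) →
      Derivable (Γ ++ [A] ++ Δ) C)
    (h : ∀ U ∈ expansions A ^ n, Derivable (Γ ++ U ++ Δ) C) :
    Derivable (Γ ++ List.replicate n A ++ Δ) C := by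
  induction n generalizing Γ with
  | zero => simpa using h [] (by simp)
  | succ n ihn =>
    have := ih Γ (List.replicate n A ++ Δ) fun U hU => by
      rw [← List.append_assoc]
      refine ihn fun V hV => ?_
      simpa using h (U ++ V) (by rw [pow_succ']; exact Language.append_mem_mul hU hV)
    simpa [List.replicate_succ] using this

theorem derivable_of_expansions {A C : Formula} {Γ Δ : List Formula}
    (h : ∀ U ∈ expansions A, Derivable (Γ ++ U ++ Δ) C) : Derivable (Γ ++ [A] ++ Δ) C := by
  induction A generalizing Γ Δ with
  | var | ldiv | rdiv => exact h _ rfl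
  | mul A B ihA ihB =>
    refine .mul_left _ _ _ _ _ ?_
    have := @ihA Γ (B :: Δ) fun U hU => by
      have := @ihB (Γ ++ U) Δ fun V hV => by
        simpa using h (U ++ V) (Language.append_mem_mul hU hV)
      simpa using this
    simpa using this
  | star A ih =>
    refine .star_left _ _ _ _ fun n => ?_
    exact derivable_replicate_of_expansions (fun Γ Δ => @ih Γ Δ)
      fun U hU => h U ((pow_le_kstar : expansions A ^ n ≤ _) hU)

theorem derivable_of_expansions_antecedent {C : Formula} {Γ Δ : List Formula}
    (h : ∀ U ∈ (Γ.map expansions).prod, Derivable (Δ ++ U) C) : Derivable (Δ ++ Γ) C := by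
  induction Γ generalizing Δ with
  | nil => exact h [] (by simp)
  | cons A Γ ih =>
    have := @derivable_of_expansions A C Δ Γ fun U hU => ih fun V hV => by
      rw [List.append_assoc]
      exact h _ (by simpa using Language.append_mem_mul hU hV)
    simpa using this

theorem StarExternal.divisionOnly_of_mem_expansions {A : Formula} (hA : StarExternal A)
    {U : List Formula} (hU : U ∈ expansions A) : ∀ D ∈ U, DivisionOnly D := by
  induction hA generalizing U with
  | ofDivisionOnly hA =>
    rw [hA.mem_expansions_iff] at hU
    simpa [hU] using hA
  | mul _ _ ihA ihB =>
    obtain ⟨V, hV, W, hW, rfl⟩ := Language.mem_mul.1 hU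
    intro D hD
    exact (List.mem_append.1 hD).elim (ihA hV D) (ihB hW D)
  | star _ ih =>
    obtain ⟨L, rfl, hL⟩ := Language.mem_kstar.1 hU
    intro D hD
    obtain ⟨V, hV, hD⟩ := List.mem_flatten.1 hD
    exact ih (hL V hV) D hD

theorem divisionOnly_of_mem_prod_expansions {Γ : List Formula} (hΓ : ∀ A ∈ Γ, StarExternal A)
    {U : List Formula} (hU : U ∈ (Γ.map expansions).prod) : ∀ D ∈ U, DivisionOnly D := by
  induction Γ generalizing U with
  | nil => simp_all
  | cons A Γ ih =>
    obtain ⟨V, hV, W, hW, rfl⟩ := Language.mem_mul.1 (by simpa using hU)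
    intro D hD
    exact (List.mem_append.1 hD).elim
      ((hΓ A (by simp)).divisionOnly_of_mem_expansions hV D)
      (ih (fun A hA => hΓ A (by simp [hA])) hW D)

theorem langTrue_of_mem_prod_expansions {α : Type u} {val : ℕ → Language α} {Γ : List Formula}
    {B : Formula} (h : LangTrue val Γ B) {U : List Formula}
    (hU : U ∈ (Γ.map expansions).prod) : LangTrue val U B := by
  refine le_trans (?_ : _ ≤ (Γ.map (langInterp val)).prod) h
  clear h
  induction Γ generalizing U with
  | nil => simp_all
  | cons A Γ ih =>
    obtain ⟨V, hV, W, hW, rfl⟩ := Language.mem_mul.1 (by simpa using hU)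
    simpa using mul_le_mul' ((derivable_of_mem_expansions hV).prod_langInterp_le val) (ih hW)

theorem relTrue_of_mem_prod_expansions {W : Type u} {val : ℕ → SetRel W W} {Γ : List Formula}
    {B : Formula} (h : RelTrue val Γ B) {U : List Formula}
    (hU : U ∈ (Γ.map expansions).prod) : RelTrue val U B := by
  refine LE.le.trans (?_ : _ ⊆ relAntecedent val Γ) h
  clear h
  induction Γ generalizing U with
  | nil => simp_all
  | cons A Γ ih =>
    obtain ⟨V, hV, W, hW, rfl⟩ := Language.mem_mul.1 (by simpa using hU)
    rintro ⟨x, z⟩ hxz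
    obtain ⟨y, h₁, h₂⟩ := (mem_relAntecedent_append val).1 hxz
    exact ⟨y, (derivable_of_mem_expansions hV).relTrue val h₁, ih hW h₂⟩

end Expansions

/-! ### Canonical model over a finite alphabet with cofinite languages. -/

section FiniteLanguageModel

/-- The number of occurrences of variables and connectives other than divisions. -/
def Formula.weight : Formula → ℕ
  | .var _ => 1
  | .ldiv A B => A.weight + B.weight
  | .rdiv B A => B.weight + A.weight
  | .mul A B => A.weight + B.weight + 1
  | .star A => A.weight + 1

theorem Formula.one_le_weight (A : Formula) : 1 ≤ A.weight := by
  induction A <;> simp only [Formula.weight] <;> omega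

/-- The set of subformulae of a formula. -/
def Formula.subformulae : Formula → Set Formula
  | .var i => {.var i}
  | .ldiv A B => {.ldiv A B} ∪ (A.subformulae ∪ B.subformulae)
  | .rdiv B A => {.rdiv B A} ∪ (B.subformulae ∪ A.subformulae)
  | .mul A B => {.mul A B} ∪ (A.subformulae ∪ B.subformulae)
  | .star A => {.star A} ∪ A.subformulae

theorem Formula.finite_subformulae (A : Formula) : A.subformulae.Finite := by
  induction A with
  | var i => exact Set.finite_singleton _
  | ldiv A B ihA ihB => exact (Set.finite_singleton _).union (ihA.union ihB)
  | rdiv B A ihB ihA => exact (Set.finite_singleton _).union (ihB.union ihA)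
  | mul A B ihA ihB => exact (Set.finite_singleton _).union (ihA.union ihB)
  | star A ih => exact (Set.finite_singleton _).union ih

theorem Formula.self_mem_subformulae (A : Formula) : A ∈ A.subformulae := by
  cases A <;> simp [subformulae]

variable {α : Type u} (f : α → Formula)

/-- The total weight of a word over an alphabet of formulae. -/
def wordWeight (U : List α) : ℕ := (U.map fun a => (f a).weight).sum

@[simp]
theorem wordWeight_append (U V : List α) :
    wordWeight f (U ++ V) = wordWeight f U + wordWeight f V := by
  simp [wordWeight]

@[simp]
theorem wordWeight_singleton (a : α) : wordWeight f [a] = (f a).weight := by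
  simp [wordWeight]

theorem length_le_wordWeight (U : List α) : U.length ≤ wordWeight f U := by
  induction U with
  | nil => simp
  | cons a U ih =>
    have := (f a).one_le_weight
    simp only [wordWeight, List.length_cons, List.map_cons, List.sum_cons] at ih ⊢
    omega

/-- The canonical valuation over an alphabet of formulae in which only the underivable sequents of
weight at most `N` are refuted. -/
def boundedVal (N : ℕ) (i : ℕ) : Language α :=
  {U : List α | wordWeight f U + 1 ≤ N → Derivable (U.map f) (.var i)}

/-- The two halves are not converse: each leaves a margin of `A.weight`, which makes the
simultaneous induction close. A division weighs exactly the sum of its arguments, and the one-letter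
word for `A` has weight exactly `A.weight`, so it just meets the lower bound in the first half. -/
theorem boundedVal_truth (N : ℕ) {A : Formula} (hA : DivisionOnly A)
    (hf : A.subformulae ⊆ Set.range f) :
    (∀ U : List α, A.weight ≤ wordWeight f U →
      (wordWeight f U ≤ N → Derivable (U.map f) A) → U ∈ langInterp (boundedVal f N) A) ∧
    (∀ U ∈ langInterp (boundedVal f N) A, wordWeight f U + A.weight ≤ N →
      Derivable (U.map f) A) := by
  induction hA with
  | var i => exact ⟨fun U _ h hN => h (by omega), fun U h hN => h hN⟩
  | @ldiv A B _ _ ihA ihB =>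
    simp only [Formula.subformulae, Set.union_subset_iff] at hf
    obtain ⟨hA₁, hA₂⟩ := ihA hf.2.1
    obtain ⟨hB₁, hB₂⟩ := ihB hf.2.2
    constructor
    · intro U hw hU V hV
      simp only [Formula.weight] at hw
      refine hB₁ _ (by simp; omega) fun hN => ?_
      simp only [wordWeight_append] at hN
      -- The lower bound on the weight of `U` supplies the margin `A.weight` required here for `V`.
      have h₁ := hA₂ V hV (by omega)
      have h₂ := Derivable.cut (V.map f) _ [] _ _ (hU (by omega))
        (.ldiv_left [] _ [] _ _ _ h₁ (.ax B))
      simpa using h₂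
    · intro U hU hN
      simp only [Formula.weight] at hN
      obtain ⟨a, ha⟩ := hf.2.1 A.self_mem_subformulae
      have h₁ := hU [a] (hA₁ [a] (by simp [ha]) fun _ => by simpa [ha] using .ax A)
      have h₂ := hB₂ ([a] ++ U) h₁ (by rw [wordWeight_append, wordWeight_singleton, ha]; omega)
      exact .ldiv_right _ _ _ (by simpa [ha] using h₂)
  | @rdiv B A _ _ ihB ihA =>
    simp only [Formula.subformulae, Set.union_subset_iff] at hf
    obtain ⟨hA₁, hA₂⟩ := ihA hf.2.2
    obtain ⟨hB₁, hB₂⟩ := ihB hf.2.1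
    constructor
    · intro U hw hU V hV
      simp only [Formula.weight] at hw
      refine hB₁ _ (by simp; omega) fun hN => ?_
      simp only [wordWeight_append] at hN
      have h₁ := hA₂ V hV (by omega)
      have h₂ := Derivable.cut [] _ (V.map f) _ B (hU (by omega))
        (by simpa using Derivable.rdiv_left [] _ [] _ _ _ h₁ (.ax B))
      simpa using h₂
    · intro U hU hN
      simp only [Formula.weight] at hN
      obtain ⟨a, ha⟩ := hf.2.2 A.self_mem_subformulae
      have h₁ := hU [a] (hA₁ [a] (by simp [ha]) fun _ => by simpa [ha] using .ax A)
      have h₂ := hB₂ _ h₁ (by simp [ha]; omega)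
      exact .rdiv_right _ _ _ (by simpa [ha] using h₂)

/-- Myhill–Nerode: all left quotients are subsets of one finite set of words. -/
theorem isRegular_of_length_le [Finite α] {L : Language α} {N : ℕ}
    (h : ∀ U ∈ L, U.length ≤ N) : L.IsRegular := by
  refine .of_finite_range_leftQuotient
    ((List.finite_length_le α N).powerset.subset ?_)
  rintro _ ⟨U, rfl⟩ V hV
  have := h _ ((Language.mem_leftQuotient U V).1 hV)
  simp only [List.length_append] at this
  exact (by omega : V.length ≤ N)

theorem isRegular_boundedVal [Finite α] (N i : ℕ) : (boundedVal f N i).IsRegular := by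
  refine .of_compl (isRegular_of_length_le (N := N) fun U hU => ?_)
  have h : ¬ (wordWeight f U + 1 ≤ N → Derivable (U.map f) (.var i)) := hU
  have := length_le_wordWeight f U
  rw [Classical.not_imp] at h
  omega

theorem mem_prod_langInterp_boundedVal {N : ℕ} {U : List α}
    (hU : ∀ a ∈ U, DivisionOnly (f a) ∧ (f a).subformulae ⊆ Set.range f) :
    U ∈ ((U.map f).map (langInterp (boundedVal f N))).prod := by
  induction U with
  | nil => simp
  | cons a U ih =>
    obtain ⟨h₁, h₂⟩ := hU a (by simp)
    have := (boundedVal_truth f N h₁ h₂).1 [a] (by simp) fun _ => .ax _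
    simpa using Language.append_mem_mul this (ih fun b hb => hU b (by simp [hb]))

theorem derivable_of_trueInAllReglanModels {Γ : List Formula} {B : Formula}
    (hΓ : ∀ A ∈ Γ, DivisionOnly A) (hB : DivisionOnly B)
    (h : TrueInAllReglanModels.{u} Γ B) : Derivable Γ B := by
  let F : Set Formula := ⋃ A ∈ {A | A ∈ B :: Γ}, A.subformulae
  have hF : F.Finite := (B :: Γ).finite_toSet.biUnion fun A _ => A.finite_subformulae
  have : Finite F := hF
  let f : ULift.{u} F → Formula := fun a => a.down.1
  have hf : ∀ A ∈ B :: Γ, A.subformulae ⊆ Set.range f := fun A hA D hD =>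
    ⟨⟨⟨D, Set.mem_biUnion (show A ∈ {A | A ∈ B :: Γ} from hA) hD⟩⟩, rfl⟩
  obtain ⟨U, hU⟩ : Γ ∈ Set.range (List.map f) := by
    rw [Set.range_list_map]
    exact fun A hA => hf A (by simp [hA]) A.self_mem_subformulae
  rw [← hU]
  -- The least bound for which membership of `U` in the interpretation of `B` still yields
  -- derivability.
  refine (boundedVal_truth f (wordWeight f U + B.weight) hB (hf B (by simp))).2 U ?_ le_rfl
  refine h _ _ (fun i => isRegular_boundedVal f _ i) U ?_
  rw [← hU]
  refine mem_prod_langInterp_boundedVal f fun a ha => ?_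
  have : f a ∈ Γ := hU ▸ List.mem_map_of_mem ha
  exact ⟨hΓ _ this, hf _ (List.mem_cons_of_mem _ this)⟩

end FiniteLanguageModel

/-! ### Canonical relational model on a free group. -/

section FreeGroupModel

variable {α : Type u}

/-- The element of the free group represented by a word without inverses. -/
def posWord (U : List α) : FreeGroup α := .mk (U.map fun a => (a, true))

@[simp]
theorem posWord_nil : posWord ([] : List α) = 1 := rfl

@[simp]
theorem posWord_append (U V : List α) : posWord (U ++ V) = posWord U * posWord V := by
  simp [posWord]

@[simp]
theorem posWord_singleton (a : α) : posWord [a] = .of a := rfl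

theorem posWord_cons (a : α) (U : List α) : posWord (a :: U) = .of a * posWord U :=
  posWord_append [a] U

theorem FreeGroup.IsReduced.mk_inj {L₁ L₂ : List (α × Bool)} (h₁ : FreeGroup.IsReduced L₁)
    (h₂ : FreeGroup.IsReduced L₂) (h : FreeGroup.mk L₁ = FreeGroup.mk L₂) : L₁ = L₂ := by
  classical
  rw [← h₁.reduce_eq, ← h₂.reduce_eq]
  exact FreeGroup.reduce.sound h

theorem isReduced_posWord (U : List α) : FreeGroup.IsReduced (U.map fun a => (a, true)) := by
  rw [FreeGroup.IsReduced, List.isChain_map]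
  exact (List.pairwise_of_forall (fun _ _ _ => rfl)).isChain

theorem posWord_injective : Function.Injective (posWord (α := α)) := fun U V h =>
  List.map_injective_iff.2 (fun a b hab => by simpa using hab)
    (FreeGroup.IsReduced.mk_inj (isReduced_posWord U) (isReduced_posWord V) h)

/-- If `g` is not positive, nothing cancels in `a⁻¹U` or `b⁻¹V`; both are then reduced forms of `g`,
with different first letters. -/
theorem exists_eq_posWord_of_of_mul {a b : α} (hab : a ≠ b) {g : FreeGroup α} {U V : List α}
    (hU : .of a * g = posWord U) (hV : .of b * g = posWord V) : ∃ T, g = posWord T := by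
  have key : ∀ (c : α) (T : List α), .of c * g = posWord T → (∃ S, g = posWord S) ∨
      FreeGroup.IsReduced ((c, false) :: T.map fun a => (a, true)) := by
    rintro c (_ | ⟨d, T⟩) hT
    · exact .inr FreeGroup.IsReduced.singleton
    · by_cases hcd : c = d
      · subst hcd
        exact .inl ⟨T, mul_left_cancel (hT.trans (posWord_cons c T))⟩
      · refine .inr (List.isChain_cons_cons.2 ⟨fun h => absurd h hcd, isReduced_posWord (d :: T)⟩)
  obtain h | h₁ := key a U hU
  · exact h
  obtain h | h₂ := key b V hV
  · exact h
  have h := FreeGroup.IsReduced.mk_inj h₁ h₂ <| by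
    have e : ∀ (c : α) (T : List α), FreeGroup.mk ((c, false) :: T.map fun a => (a, true)) =
        (FreeGroup.of c)⁻¹ * posWord T := fun c T => rfl
    rw [e, e, ← hU, ← hV, inv_mul_cancel_left, inv_mul_cancel_left]
  simp [hab] at h

theorem exists_eq_posWord_of_mul_of {a b : α} (hab : a ≠ b) {g : FreeGroup α} {U V : List α}
    (hU : g * .of a = posWord U) (hV : g * .of b = posWord V) : ∃ T, g = posWord T := by
  have key : ∀ (c : α) (T : List α), g * .of c = posWord T → (∃ S, g = posWord S) ∨
      FreeGroup.IsReduced ((T.map fun a => (a, true)) ++ [(c, false)]) := by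
    intro c T hT
    obtain rfl | ⟨T, d, rfl⟩ := T.eq_nil_or_concat'
    · exact .inr FreeGroup.IsReduced.singleton
    · by_cases hcd : c = d
      · subst hcd
        exact .inl ⟨T, mul_right_cancel (hT.trans (posWord_append T [c]))⟩
      · refine .inr (List.IsChain.append (isReduced_posWord _) (List.isChain_singleton _) ?_)
        simp [Ne.symm hcd]
  obtain h | h₁ := key a U hU
  · exact h
  obtain h | h₂ := key b V hV
  · exact h
  have h := FreeGroup.IsReduced.mk_inj h₁ h₂ <| by
    have e : ∀ (c : α) (T : List α), FreeGroup.mk ((T.map fun a => (a, true)) ++ [(c, false)]) =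
        posWord T * (FreeGroup.of c)⁻¹ := fun c T => rfl
    rw [e, e, ← hU, ← hV, mul_inv_cancel_right, mul_inv_cancel_right]
  simp [hab] at h

variable (f : α → Formula)

/-- The canonical valuation by binary relations on the free group over an alphabet of formulae. -/
def freeGroupVal (i : ℕ) : SetRel (FreeGroup α) (FreeGroup α) :=
  {p | ∃ U, p.2 = p.1 * posWord U ∧ Derivable (U.map f) (.var i)}

/-- Provides a second letter, different from `A`, that derives `A`. -/
theorem derivable_rdiv_ldiv_self (A : Formula) : Derivable [.rdiv A (.ldiv A A)] A :=
  .rdiv_left [] [] [] (.ldiv A A) A A (.ldiv_right _ _ _ (.ax A)) (.ax A)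

theorem Formula.ne_rdiv (A B : Formula) : A ≠ .rdiv A B := fun h => by
  have := congrArg sizeOf h
  simp only [Formula.rdiv.sizeOf_spec] at this
  omega

variable {f}

theorem mem_relInterp_freeGroupVal_iff (hf : Function.Surjective f) {A : Formula}
    (hA : DivisionOnly A) {x y : FreeGroup α} :
    (x, y) ∈ relInterp (freeGroupVal f) A ↔
      ∃ U, y = x * posWord U ∧ Derivable (U.map f) A := by
  induction hA generalizing x y with
  | var i => rfl
  | @ldiv A B _ _ ihA ihB =>
    simp only [relInterp, Set.mem_ofPred_eq, ihA, ihB]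
    constructor
    · intro h
      obtain ⟨a, ha⟩ := hf A
      -- The letter `a` alone would allow `x⁻¹ * y` to begin with `a⁻¹`; testing with `b` as well
      -- excludes this.
      obtain ⟨b, hb⟩ := hf (.rdiv A (.ldiv A A))
      have hab : a ≠ b := fun e => A.ne_rdiv _ (ha.symm.trans ((congrArg f e).trans hb))
      obtain ⟨U, hU, hd⟩ := h (x * (.of a)⁻¹) ⟨[a], by simp, by simpa [ha] using .ax A⟩
      obtain ⟨V, hV, -⟩ := h (x * (.of b)⁻¹)
        ⟨[b], by simp, by simpa [hb] using derivable_rdiv_ldiv_self A⟩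
      have hU' : .of a * (x⁻¹ * y) = posWord U := by rw [hU]; group
      have hV' : .of b * (x⁻¹ * y) = posWord V := by rw [hV]; group
      obtain ⟨T, hT⟩ := exists_eq_posWord_of_of_mul hab hU' hV'
      rw [hT, ← posWord_cons] at hU'
      obtain rfl := posWord_injective hU'
      exact ⟨T, by rw [← hT]; group, .ldiv_right _ _ _ (by simpa [ha] using hd)⟩
    · rintro ⟨U, rfl, hU⟩ z ⟨V, rfl, hV⟩
      refine ⟨V ++ U, by simp [mul_assoc], ?_⟩
      simpa using Derivable.cut (V.map f) _ [] _ _ hU (.ldiv_left [] _ [] _ _ _ hV (.ax B))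
  | @rdiv B A _ _ ihB ihA =>
    simp only [relInterp, Set.mem_ofPred_eq, ihA, ihB]
    constructor
    · intro h
      obtain ⟨a, ha⟩ := hf A
      obtain ⟨b, hb⟩ := hf (.rdiv A (.ldiv A A))
      have hab : a ≠ b := fun e => A.ne_rdiv _ (ha.symm.trans ((congrArg f e).trans hb))
      obtain ⟨U, hU, hd⟩ := h (y * .of a) ⟨[a], by simp, by simpa [ha] using .ax A⟩
      obtain ⟨V, hV, -⟩ := h (y * .of b)
        ⟨[b], by simp, by simpa [hb] using derivable_rdiv_ldiv_self A⟩
      have hU' : x⁻¹ * y * .of a = posWord U := by rw [mul_assoc, hU]; group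
      have hV' : x⁻¹ * y * .of b = posWord V := by rw [mul_assoc, hV]; group
      obtain ⟨T, hT⟩ := exists_eq_posWord_of_mul_of hab hU' hV'
      rw [hT, ← posWord_singleton, ← posWord_append] at hU'
      obtain rfl := posWord_injective hU'
      exact ⟨T, by rw [← hT]; group, .rdiv_right _ _ _ (by simpa [ha] using hd)⟩
    · rintro ⟨U, rfl, hU⟩ z ⟨V, rfl, hV⟩
      refine ⟨U ++ V, by simp [mul_assoc], ?_⟩
      simpa using Derivable.cut [] _ (V.map f) _ B hU
        (by simpa using Derivable.rdiv_left [] _ [] _ _ _ hV (.ax B))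

theorem mem_relAntecedent_freeGroupVal (hf : Function.Surjective f) {U : List α}
    (hU : ∀ a ∈ U, DivisionOnly (f a)) (x : FreeGroup α) :
    (x, x * posWord U) ∈ relAntecedent (freeGroupVal f) (U.map f) := by
  induction U generalizing x with
  | nil => simp [relAntecedent]
  | cons a U ih =>
    refine ⟨x * .of a, ?_, ?_⟩
    · exact (mem_relInterp_freeGroupVal_iff hf (hU a (by simp))).2 ⟨[a], rfl, .ax _⟩
    · rw [posWord_cons, ← mul_assoc]
      exact ih (fun b hb => hU b (by simp [hb])) _

theorem derivable_of_trueInAllRModels {Γ : List Formula} {B : Formula}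
    (hΓ : ∀ A ∈ Γ, DivisionOnly A) (hB : DivisionOnly B)
    (h : TrueInAllRModels.{u} Γ B) : Derivable Γ B := by
  have hf : Function.Surjective (ULift.down : ULift.{u} Formula → Formula) :=
    ULift.down_surjective
  obtain ⟨U, rfl⟩ := List.map_surjective_iff.2 hf Γ
  have hmem := h _ _ (mem_relAntecedent_freeGroupVal hf
    (fun a ha => hΓ _ (List.mem_map_of_mem ha)) 1)
  obtain ⟨V, hV, hd⟩ := (mem_relInterp_freeGroupVal_iff hf hB).1 hmem
  rwa [posWord_injective (mul_left_cancel hV)]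

end FreeGroupModel

/-! ### The equivalences for *-external sequents. -/

theorem derivable_iff_trueInAllReglanModels {Γ : List Formula} {B : Formula}
    (h : StarExternalSequent Γ B) : Derivable Γ B ↔ TrueInAllReglanModels.{u} Γ B := by
  refine ⟨fun hd _ _ val _ => hd.prod_langInterp_le val, fun ht => ?_⟩
  refine derivable_of_expansions_antecedent (Δ := []) fun U hU => ?_
  exact derivable_of_trueInAllReglanModels.{u} (divisionOnly_of_mem_prod_expansions h.1 hU) h.2
    fun _ _ val hval => langTrue_of_mem_prod_expansions (ht _ val hval) hU

theorem derivable_iff_trueInAllRModels {Γ : List Formula} {B : Formula}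
    (h : StarExternalSequent Γ B) : Derivable Γ B ↔ TrueInAllRModels.{u} Γ B := by
  refine ⟨fun hd W val => hd.relTrue val, fun ht => ?_⟩
  refine derivable_of_expansions_antecedent (Δ := []) fun U hU => ?_
  exact derivable_of_trueInAllRModels.{u} (divisionOnly_of_mem_prod_expansions h.1 hU) h.2
    fun W val => relTrue_of_mem_prod_expansions (ht W val) hU

end LambekStar

theorem theorem6p2 (Γ : List LambekStar.Formula) (B : LambekStar.Formula)
    (h : LambekStar.StarExternalSequent Γ B) :
    (LambekStar.Derivable Γ B ↔ LambekStar.TrueInAllLModels.{u} Γ B) ∧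
    (LambekStar.Derivable Γ B ↔ LambekStar.TrueInAllReglanModels.{v} Γ B) ∧
    (LambekStar.Derivable Γ B ↔ LambekStar.TrueInAllRModels.{w} Γ B) :=
  ⟨⟨fun hd _ val => hd.prod_langInterp_le val,
    fun ht => (LambekStar.derivable_iff_trueInAllReglanModels.{u} h).2 fun _ _ val _ => ht _ val⟩,
    LambekStar.derivable_iff_trueInAllReglanModels h,
    LambekStar.derivable_iff_trueInAllRModels h⟩
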